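/- Let $(\mathscr{A},\mathbb{E},\mathfrak{s})$ be a Krull–Schmidt extriangulated category (in the sense of Nakaoka and Palu) with enough projectives and enough injectives, satisfying the condition (WIC): if $gf$ is an inflation then so is $f$, and if $gf$ is a deflation then so is $g$. "Subcategory" means a full additive subcategory closed under isomorphisms and direct summands, and an $\mathbb{E}$-triangle $A\to B\to Z\dashrightarrow$ is a sequence realizing an element of $\mathbb{E}(Z,A)$. Put $\mathbb{E}^{i+1}(X,Y)=\mathbb{E}(\Omega^iX,Y)$ for $i\ge 0$, where $\Omega$ denotes the syzygy. For a class $\omega$ of objects let $$\omega^{\perp}=\{Y : \mathbb{E}^i(X,Y)=0\ \ \forall i\ge 1,\ \forall X\in\omega\},\qquad {}^{\perp}\omega=\{Y : \mathbb{E}^i(Y,X)=0\ \ \forall i\ge 1,\ \forall X\in\omega\};$$ let $\hat\omega$ (respectively $\check\omega$) be the class of objects $A$ admitting, for some $n\ge 0$, a finite sequence $W_n\to\cdots\to W_0\to A$ (respectively $A\to W^0\to\cdots\to W^n$) spliced from $\mathbb{E}$-triangles, with all $W_i\in\omega$ (respectively $W^i\in\omega$); and let ${}_{\omega}\mathcal{X}$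 be the class of objects $A$ for which there are $\mathbb{E}$-triangles $K_{n+1}\to W_n\to K_n\dashrightarrow$ ($n\ge 0$) with $K_0=A$, all $W_n\in\omega$ and all $K_n\in\omega^{\perp}$. Let $\mathcal{C}$ be a self-orthogonal subcategory of $\mathscr{A}$ (that is, $\mathcal{C}\subseteq\mathcal{C}^{\perp}$) such that $({}_{\mathcal{C}}\mathcal{X})^{\vee}$ is finitely filtered: there is a finite set $\mathcal{S}$ of objects of $({}_{\mathcal{C}}\mathcal{X})^{\vee}$ such that every object $M$ of it admits $\mathbb{E}$-triangles $M_{i-1}\to M_i\to S_i\dashrightarrow$ ($1\le i\le n$, $n \ge 1$) with $M_0=0$, $M_n=M$ and all $S_i\in\mathcal{S}$. Let $\mathcal{D}\subseteq{}_{\mathcal{C}}\mathcal{X}$ be a subcategory which is - strongly covariantly finite in ${}_{\mathcal{C}}\mathcal{X}$: each $M\in{}_{\mathcal{C}}\mathcal{X}$ has an $\mathbb{E}$-triangle $M\xrightarrow{g}W\to V\dashrightarrow$ in which $g$ is a left $\mathcal{D}$-approximation (that is, $W\in\mathcal{D}$ and every morphism from $M$ to an object of $\mathcal{D}$ factors through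 $g$); and - relative coresolving in ${}_{\mathcal{C}}\mathcal{X}$: $\mathcal{D}$ is closed under extensions, direct summands and cones of inflations, and contains every injective object of ${}_{\mathcal{C}}\mathcal{X}$, that is, every $I\in{}_{\mathcal{C}}\mathcal{X}$ such that for each $\mathbb{E}$-triangle $A\to B\to Z\dashrightarrow$ with $A,B,Z\in{}_{\mathcal{C}}\mathcal{X}$ every morphism $A\to I$ factors through $A\to B$. Then $\check{\mathcal{D}}=({}_{\mathcal{C}}\mathcal{X})^{\vee}$ if and only if ${}^{\perp}\mathcal{D}\cap{}_{\mathcal{C}}\mathcal{X}\subseteq\hat{\mathcal{C}}$. -/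

import Mathlib

open CategoryTheory CategoryTheory.Limits Opposite

universe w v u

namespace Extri

section Bifunctor

variable {C : Type u} [Category.{v} C]

/-- The elements of `𝔼(Z, A)`: the extensions of `Z` by `A`. -/
abbrev Elt (E : Cᵒᵖ ⥤ C ⥤ AddCommGrpCat.{w}) (Z A : C) : Type w :=
  (E.obj (op Z)).obj A

/-- `a_* δ = 𝔼(Z, a)(δ)`. -/
abbrev push (E : Cᵒᵖ ⥤ C ⥤ AddCommGrpCat.{w}) {Z A A' : C} (a : A ⟶ A')
    (δ : Elt E Z A) : Elt E Z A' :=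
  (E.obj (op Z)).map a δ

/-- `c^* δ = 𝔼(c, A)(δ)`. -/
abbrev pull (E : Cᵒᵖ ⥤ C ⥤ AddCommGrpCat.{w}) {Z Z' A : C} (c : Z' ⟶ Z)
    (δ : Elt E Z A) : Elt E Z' A :=
  (E.map c.op).app A δ

/-- `δ ⊕ δ' ∈ 𝔼(Z ⊞ Z', A ⊞ A')`: the element with components `δ, 0, 0, δ'`. -/
noncomputable def sumElt [Preadditive C] [HasBinaryBiproducts C]
    (E : Cᵒᵖ ⥤ C ⥤ AddCommGrpCat.{w})
    {Z A Z' A' : C} (δ : Elt E Z A) (δ' : Elt E Z' A') : Elt E (Z ⊞ Z') (A ⊞ A') :=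
  push E biprod.inl (pull E biprod.fst δ) + push E biprod.inr (pull E biprod.snd δ')

end Bifunctor

/-- An extriangulated structure (in the sense of Nakaoka and Palu) on an additive category `C`.
The realization `𝔰`, which sends `δ ∈ 𝔼(Z, A)` to an equivalence class of sequences
`A ⟶ B ⟶ Z`, is encoded by the predicate `Realizes δ x y`, meaning `𝔰(δ) = [A --x--> B --y--> Z]`;
the fields `exists_realizes`, `equiv_of_realizes` and `realizes_of_equiv` say that for each `δ` the
sequences realizing `δ` form exactly one equivalence class. -/
structure ExtriangulatedStructure (C : Type u) [Category.{v} C] [Preadditive C]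
    [HasZeroObject C] [HasBinaryBiproducts C] where
  /-- (ET1): the biadditive functor `𝔼`. -/
  E : Cᵒᵖ ⥤ C ⥤ AddCommGrpCat.{w}
  additive_left : E.Additive
  additive_right : ∀ Z : Cᵒᵖ, (E.obj Z).Additive
  /-- `𝔰(δ) = [A --x--> B --y--> Z]`. -/
  Realizes : ∀ {Z A B : C}, Elt E Z A → (A ⟶ B) → (B ⟶ Z) → Prop
  exists_realizes : ∀ {Z A : C} (δ : Elt E Z A),
    ∃ (B : C) (x : A ⟶ B) (y : B ⟶ Z), Realizes δ x y
  equiv_of_realizes : ∀ {Z A B B' : C} (δ : Elt E Z A) (x : A ⟶ B) (y : B ⟶ Z)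
    (x' : A ⟶ B') (y' : B' ⟶ Z), Realizes δ x y → Realizes δ x' y' →
    ∃ b : B ≅ B', x ≫ b.hom = x' ∧ b.hom ≫ y' = y
  realizes_of_equiv : ∀ {Z A B B' : C} (δ : Elt E Z A) (x : A ⟶ B) (y : B ⟶ Z)
    (b : B ≅ B') (x' : A ⟶ B') (y' : B' ⟶ Z), Realizes δ x y →
    x ≫ b.hom = x' → b.hom ≫ y' = y → Realizes δ x' y'
  /-- The defining property of a realization: every morphism of extensions is realized. -/
  realize_hom : ∀ {Z A B Z' A' B' : C} (δ : Elt E Z A) (δ' : Elt E Z' A')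
    (x : A ⟶ B) (y : B ⟶ Z) (x' : A' ⟶ B') (y' : B' ⟶ Z') (a : A ⟶ A') (c : Z ⟶ Z'),
    Realizes δ x y → Realizes δ' x' y' → push E a δ = pull E c δ' →
    ∃ b : B ⟶ B', x ≫ b = a ≫ x' ∧ y ≫ c = b ≫ y'
  /-- (ET2)(i): the zero extension is realized by the split sequence. -/
  realizes_zero : ∀ Z A : C,
    Realizes (0 : Elt E Z A) (biprod.inl : A ⟶ A ⊞ Z) (biprod.snd : A ⊞ Z ⟶ Z)
  /-- (ET2)(ii): `𝔰(δ ⊕ δ') = 𝔰(δ) ⊕ 𝔰(δ')`. -/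
  realizes_sum : ∀ {Z A B Z' A' B' : C} (δ : Elt E Z A) (δ' : Elt E Z' A')
    (x : A ⟶ B) (y : B ⟶ Z) (x' : A' ⟶ B') (y' : B' ⟶ Z'),
    Realizes δ x y → Realizes δ' x' y' →
    Realizes (sumElt E δ δ') (biprod.map x x') (biprod.map y y')
  /-- (ET3). -/
  et3 : ∀ {Z A B Z' A' B' : C} (δ : Elt E Z A) (δ' : Elt E Z' A')
    (x : A ⟶ B) (y : B ⟶ Z) (x' : A' ⟶ B') (y' : B' ⟶ Z') (a : A ⟶ A') (b : B ⟶ B'),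
    Realizes δ x y → Realizes δ' x' y' → x ≫ b = a ≫ x' →
    ∃ c : Z ⟶ Z', push E a δ = pull E c δ' ∧ y ≫ c = b ≫ y'
  /-- (ET3)ᵒᵖ. -/
  et3_op : ∀ {Z A B Z' A' B' : C} (δ : Elt E Z A) (δ' : Elt E Z' A')
    (x : A ⟶ B) (y : B ⟶ Z) (x' : A' ⟶ B') (y' : B' ⟶ Z') (b : B ⟶ B') (c : Z ⟶ Z'),
    Realizes δ x y → Realizes δ' x' y' → y ≫ c = b ≫ y' →
    ∃ a : A ⟶ A', push E a δ = pull E c δ' ∧ x ≫ b = a ≫ x'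
  /-- (ET4). -/
  et4 : ∀ {A B D X F : C} (δ : Elt E D A) (δ' : Elt E F B)
    (f : A ⟶ B) (f' : B ⟶ D) (g : B ⟶ X) (g' : X ⟶ F),
    Realizes δ f f' → Realizes δ' g g' →
    ∃ (Y : C) (h' : X ⟶ Y) (d : D ⟶ Y) (e : Y ⟶ F) (δ'' : Elt E Y A),
      Realizes δ'' (f ≫ g) h' ∧ g ≫ h' = f' ≫ d ∧ h' ≫ e = g' ∧
      Realizes (push E f' δ') d e ∧
      pull E d δ'' = δ ∧
      push E f δ'' = pull E e δ'
  /-- (ET4)ᵒᵖ. -/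
  et4_op : ∀ {A B D X F : C} (δ : Elt E A D) (δ' : Elt E B F)
    (f' : D ⟶ B) (f : B ⟶ A) (g' : F ⟶ X) (g : X ⟶ B),
    Realizes δ f' f → Realizes δ' g' g →
    ∃ (Y : C) (h' : Y ⟶ X) (d : Y ⟶ D) (e : F ⟶ Y) (δ'' : Elt E A Y),
      Realizes δ'' h' (g ≫ f) ∧ h' ≫ g = d ≫ f' ∧ e ≫ h' = g' ∧
      Realizes (pull E f' δ') e d ∧
      push E d δ'' = δ ∧
      pull E f δ'' = push E e δ'

section

variable {C : Type u} [Category.{v} C] [Preadditive C] [HasZeroObject C] [HasBinaryBiproducts C]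

/-- Every object is a finite direct sum of objects with local endomorphism rings. -/
def IsKrullSchmidt (C : Type u) [Category.{v} C] [Preadditive C] : Prop :=
  ∀ X : C, ∃ (n : ℕ) (f : Fin n → C) (b : Bicone f),
    (∀ i, IsLocalRing (End (f i))) ∧ Nonempty b.IsBilimit ∧ Nonempty (X ≅ b.pt)

/-- Full additive subcategories closed under isomorphisms and direct summands. -/
structure IsSubcategory (P : ObjectProperty C) : Prop where
  zero : ∀ Z : C, IsZero Z → P Z
  biprod : ∀ X Y : C, P X → P Y → P (X ⊞ Y)
  iso : ∀ X Y : C, (X ≅ Y) → P X → P Y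
  summand : ∀ X Y : C, P (X ⊞ Y) → P X

end

namespace ExtriangulatedStructure

variable {C : Type u} [Category.{v} C] [Preadditive C] [HasZeroObject C] [HasBinaryBiproducts C]
  (T : ExtriangulatedStructure.{w} C)

/-- `A --x--> B --y--> Z` is a conflation: it realizes some extension. -/
def IsConflation {A B Z : C} (x : A ⟶ B) (y : B ⟶ Z) : Prop :=
  ∃ δ : Elt T.E Z A, T.Realizes δ x y

def IsInflation {A B : C} (x : A ⟶ B) : Prop :=
  ∃ (Z : C) (y : B ⟶ Z), T.IsConflation x y

def IsDeflation {B Z : C} (y : B ⟶ Z) : Prop :=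
  ∃ (A : C) (x : A ⟶ B), T.IsConflation x y

/-- There is an `𝔼`-triangle `A ⟶ B ⟶ Z ⇢`. -/
def Triangle (A B Z : C) : Prop :=
  ∃ (x : A ⟶ B) (y : B ⟶ Z), T.IsConflation x y

/-- Weak idempotent completeness. -/
def WIC : Prop :=
  (∀ {A B Z : C} (f : A ⟶ B) (g : B ⟶ Z), T.IsInflation (f ≫ g) → T.IsInflation f) ∧
  (∀ {A B Z : C} (f : A ⟶ B) (g : B ⟶ Z), T.IsDeflation (f ≫ g) → T.IsDeflation g)

def IsProjective (P : C) : Prop :=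
  ∀ {A B Z : C} (x : A ⟶ B) (y : B ⟶ Z), T.IsConflation x y →
    ∀ c : P ⟶ Z, ∃ b : P ⟶ B, b ≫ y = c

/-- `I` is an injective object of the subcategory `Y`, whose `𝔼`-triangles are those of the ambient
category with all terms in `Y`. -/
def IsInjectiveIn (Y : ObjectProperty C) (I : C) : Prop :=
  Y I ∧ ∀ {A B Z : C} (x : A ⟶ B) (y : B ⟶ Z), Y A → Y B → Y Z → T.IsConflation x y →
    ∀ a : A ⟶ I, ∃ b : B ⟶ I, x ≫ b = a

def IsInjective (I : C) : Prop := T.IsInjectiveIn ⊤ I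

class HasEnoughProjectives : Prop where
  exists_triangle : ∀ Z : C, ∃ A P : C, T.IsProjective P ∧ T.Triangle A P Z

class HasEnoughInjectives : Prop where
  exists_triangle : ∀ A : C, ∃ I Z : C, T.IsInjective I ∧ T.Triangle A I Z

/-- A chosen syzygy `Ω Z`: there is an `𝔼`-triangle `Ω Z ⟶ P ⟶ Z ⇢` with `P` projective. -/
noncomputable def syzygy [T.HasEnoughProjectives] (Z : C) : C :=
  (HasEnoughProjectives.exists_triangle (T := T) Z).choose

/-- The iterated syzygy `Ωⁱ Z`. -/
noncomputable def iterSyzygy [T.HasEnoughProjectives] : ℕ → C → C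
  | 0, Z => Z
  | i + 1, Z => T.syzygy (iterSyzygy i Z)

/-- The higher extension group `𝔼^{i+1}(X, Y) = 𝔼(Ωⁱ X, Y)`; note the shift of the index.
Up to isomorphism it does not depend on the choice of syzygies. -/
abbrev ExtSucc [T.HasEnoughProjectives] (i : ℕ) (X Y : C) : Type w :=
  Elt T.E (T.iterSyzygy i X) Y

section Orthogonal

variable [T.HasEnoughProjectives]

/-- `ω^⊥ = {Y | 𝔼ⁱ(X, Y) = 0 for all i ≥ 1 and X ∈ ω}`. -/
def rightPerp (ω : ObjectProperty C) : ObjectProperty C :=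
  fun Y => ∀ X, ω X → ∀ (i : ℕ) (e : T.ExtSucc i X Y), e = 0

/-- `^⊥ω = {Y | 𝔼ⁱ(Y, X) = 0 for all i ≥ 1 and X ∈ ω}`. -/
def leftPerp (ω : ObjectProperty C) : ObjectProperty C :=
  fun Y => ∀ X, ω X → ∀ (i : ℕ) (e : T.ExtSucc i Y X), e = 0

def SelfOrthogonal (ω : ObjectProperty C) : Prop := ω ≤ T.rightPerp ω

/-- `_ω𝒳`: the objects `A` with an `𝔼`-triangle sequence `⋯ ⟶ W₁ ⟶ W₀ ⟶ A`, spliced from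
`𝔼`-triangles `K_{n+1} ⟶ W_n ⟶ K_n ⇢` with `K₀ = A`, all `W_n ∈ ω` and all `K_n ∈ ω^⊥`. -/
def properRes (ω : ObjectProperty C) : ObjectProperty C :=
  fun A => ∃ K W : ℕ → C, K 0 = A ∧
    ∀ n, ω (W n) ∧ T.rightPerp ω (K n) ∧ T.Triangle (K (n + 1)) (W n) (K n)

end Orthogonal

/-- `ω̂_n`: the objects `A` with an `𝔼`-triangle sequence `W_n ⟶ ⋯ ⟶ W₁ ⟶ W₀ ⟶ A`, `W_i ∈ ω`. -/
def hatN (ω : ObjectProperty C) : ℕ → ObjectProperty C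
  | 0 => ω
  | n + 1 => fun A => ∃ K W : C, ω W ∧ hatN ω n K ∧ T.Triangle K W A

/-- `ω̌_n`: the objects `A` with an `𝔼`-triangle sequence `A ⟶ W⁰ ⟶ W¹ ⟶ ⋯ ⟶ Wⁿ`, `Wⁱ ∈ ω`. -/
def checkN (ω : ObjectProperty C) : ℕ → ObjectProperty C
  | 0 => ω
  | n + 1 => fun A => ∃ W K : C, ω W ∧ checkN ω n K ∧ T.Triangle A W K

/-- `ω̂ = ⋃ₙ ω̂_n`. -/
def hat (ω : ObjectProperty C) : ObjectProperty C := fun A => ∃ n, T.hatN ω n A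

/-- `ω̌ = ⋃ₙ ω̌_n`. -/
def check (ω : ObjectProperty C) : ObjectProperty C := fun A => ∃ n, T.checkN ω n A

/-- `M` has a finite `S`-filtration `0 = M₀ ⟶ M₁ ⟶ ⋯ ⟶ M_n = M` (`n ≥ 1`), with `𝔼`-triangles
`M_{i-1} ⟶ M_i ⟶ S_i ⇢` and `S_i ∈ S`. -/
inductive HasFiltration (S : Set C) : C → Prop
  | base (O M Q : C) : IsZero O → Q ∈ S → T.Triangle O M Q → HasFiltration S M
  | step (M' M Q : C) : HasFiltration S M' → Q ∈ S → T.Triangle M' M Q → HasFiltration S M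

def FinitelyFiltered (P : ObjectProperty C) : Prop :=
  ∃ S : Set C, S.Finite ∧ (∀ Q ∈ S, P Q) ∧ ∀ M, P M → T.HasFiltration S M

/-- `g : M ⟶ W` is a left `D`-approximation of `M`. -/
def IsLeftApprox (D : ObjectProperty C) {M W : C} (g : M ⟶ W) : Prop :=
  D W ∧ ∀ (W' : C), D W' → ∀ h : M ⟶ W', ∃ k : W ⟶ W', g ≫ k = h

/-- `D` is strongly covariantly finite in `Y`. -/
def StronglyCovariantlyFiniteIn (D Y : ObjectProperty C) : Prop :=
  D ≤ Y ∧ ∀ M, Y M → ∃ (W V : C) (g : M ⟶ W) (p : W ⟶ V),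
    T.IsConflation g p ∧ IsLeftApprox D g

/-- `D` is a relative coresolving subcategory of `Y`. -/
structure RelativeCoresolving (D Y : ObjectProperty C) : Prop where
  le : D ≤ Y
  extension : ∀ A B Z : C, T.Triangle A B Z → D A → D Z → D B
  summand : ∀ X X' : C, D (X ⊞ X') → D X
  cone : ∀ A B Z : C, T.Triangle A B Z → D A → D B → D Z
  injective : ∀ I : C, T.IsInjectiveIn Y I → D I

end ExtriangulatedStructure

end Extri

/-! Write X for `T.properRes 𝒞`. Two approximation triangles drive the proof. Each M in X has M → W
→ V with W in D and V in ^⊥D ∩ X (`exists_special_preenvelope`): Krull–Schmidt and WIC make an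
approximation left minimal, Wakamatsu's argument gives 𝔼(V, D) = 0, and `leftPerp_of_vanish` handles
the higher degrees. Applied to a syzygy of M and pushed out, this yields W → U → M with W in D and U
in ^⊥D ∩ X (`exists_special_precover`).

If Ď = X̌, the finitely many filtration factors have D-coresolutions of bounded length. So for V in
^⊥D ∩ X the groups 𝔼^j(V, -) vanish for large j on the factors, hence on X, and the 𝒞-resolution of
V can be cut off at a split triangle (`hatN_of_dimLE`).

Conversely, if ^⊥D ∩ X lies in 𝒞̂, every U above has finite projective dimension relative to X. Such
precovers exist on all of X̌ (`exists_hasPrecover_of_checkN`), and the filtration makes the bound N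
uniform (`HasFiltration.hasPrecover`). The precover of an object V of ^⊥D ∩ X splits, so V itself
has dimension at most N. Iterated preenvelopes of M in X therefore stop after N steps
(`checkN_of_extVanish`), giving X ⊆ Ď; an induction on length extends this to X̌. -/

namespace Extri

/-- Over a finite set of objects, pointwise bounds give a uniform bound. -/
lemma exists_uniform_bound {α : Type*} {S : Set α} (hS : S.Finite) {P : ℕ → α → Prop}
    (hmono : ∀ m n Q, m ≤ n → P m Q → P n Q) (h : ∀ Q ∈ S, ∃ n, P n Q) :
    ∃ n, ∀ Q ∈ S, P n Q := by
  choose! f hf using h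
  obtain ⟨N, hN⟩ := (hS.image f).bddAbove
  exact ⟨N, fun Q hQ => hmono _ _ _ (hN (Set.mem_image_of_mem f hQ)) (hf Q hQ)⟩

/-! ### Invertibility of `1 - f` and the radical -/

section Preadditive

variable {C : Type u} [Category.{v} C] [Preadditive C]

lemma isIso_one_sub_comp_swap {X Y : C} (p : X ⟶ Y) (q : Y ⟶ X) [IsIso (𝟙 Y - q ≫ p)] :
    IsIso (𝟙 X - p ≫ q) := by
  set b := inv (𝟙 Y - q ≫ p)
  have h1 : b - (q ≫ p) ≫ b = 𝟙 Y := by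
    have := IsIso.hom_inv_id (𝟙 Y - q ≫ p)
    rwa [Preadditive.sub_comp, Category.id_comp] at this
  have h2 : b - b ≫ q ≫ p = 𝟙 Y := by
    have := IsIso.inv_hom_id (𝟙 Y - q ≫ p)
    rwa [Preadditive.comp_sub, Category.comp_id] at this
  refine ⟨𝟙 X + p ≫ b ≫ q, ?_, ?_⟩
  · have := p ≫= h1 =≫ q
    simp only [Preadditive.sub_comp, Preadditive.comp_sub, Preadditive.comp_add,
      Category.id_comp, Category.comp_id, Category.assoc] at this ⊢
    rw [← this]; abel
  · have := p ≫= h2 =≫ q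
    simp only [Preadditive.sub_comp, Preadditive.comp_sub, Preadditive.add_comp,
      Category.id_comp, Category.comp_id, Category.assoc] at this ⊢
    rw [← sub_eq_zero, ← sub_eq_zero.2 this]; abel

/-- The hypothesis puts each `ι j` in the radical. With `u` the morphism for `s`, the one for
`insert j s` is `(1 - π j ≫ ι j ≫ u⁻¹) ≫ u`, and the first factor is invertible by the swap lemma.
-/
lemma isIso_one_sub_sum {J : Type*} (s : Finset J) (f : J → C) {W : C} (π : ∀ j, W ⟶ f j)
    (ι : ∀ j, f j ⟶ W) (h : ∀ j (t : W ⟶ f j), IsIso (𝟙 (f j) - ι j ≫ t)) :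
    IsIso (𝟙 W - ∑ j ∈ s, π j ≫ ι j) := by
  classical
  induction s using Finset.induction_on with
  | empty => simp only [Finset.sum_empty, sub_zero]; infer_instance
  | insert j s hj ih =>
    have := h j (inv (𝟙 W - ∑ j ∈ s, π j ≫ ι j) ≫ π j)
    have : IsIso (𝟙 (f j) - (ι j ≫ inv (𝟙 W - ∑ j ∈ s, π j ≫ ι j)) ≫ π j) := by
      rwa [Category.assoc]
    have := isIso_one_sub_comp_swap (π j) (ι j ≫ inv (𝟙 W - ∑ j ∈ s, π j ≫ ι j))
    have e : 𝟙 W - ∑ j ∈ insert j s, π j ≫ ι j =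
        (𝟙 W - π j ≫ ι j ≫ inv (𝟙 W - ∑ j ∈ s, π j ≫ ι j)) ≫ (𝟙 W - ∑ j ∈ s, π j ≫ ι j) := by
      rw [Preadditive.sub_comp, Finset.sum_insert hj]
      simp only [Category.assoc, IsIso.inv_hom_id, Category.comp_id, Category.id_comp]
      abel
    rw [e]
    infer_instance

end Preadditive

/-! ### Functoriality of `𝔼` -/

section Bifunctor

variable {C : Type u} [Category.{v} C] (E : Cᵒᵖ ⥤ C ⥤ AddCommGrpCat.{w})

lemma push_id {Z A : C} (δ : Elt E Z A) : push E (𝟙 A) δ = δ := by simp [push]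

lemma push_comp {Z A A' A'' : C} (a : A ⟶ A') (a' : A' ⟶ A'') (δ : Elt E Z A) :
    push E (a ≫ a') δ = push E a' (push E a δ) := by simp [push]

lemma pull_id {Z A : C} (δ : Elt E Z A) : pull E (𝟙 Z) δ = δ := by simp [pull]

lemma pull_comp {Z Z' Z'' A : C} (c : Z'' ⟶ Z') (c' : Z' ⟶ Z) (δ : Elt E Z A) :
    pull E (c ≫ c') δ = pull E c (pull E c' δ) := by simp [pull]

lemma push_pull {Z Z' A A' : C} (a : A ⟶ A') (c : Z' ⟶ Z) (δ : Elt E Z A) :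
    push E a (pull E c δ) = pull E c (push E a δ) :=
  (ConcreteCategory.congr_hom ((E.map c.op).naturality a) δ).symm

lemma push_zero {Z A A' : C} (a : A ⟶ A') : push E a (0 : Elt E Z A) = 0 := map_zero _

lemma pull_zero {Z Z' A : C} (c : Z' ⟶ Z) : pull E c (0 : Elt E Z A) = 0 := map_zero _

lemma push_add {Z A A' : C} (a : A ⟶ A') (δ δ' : Elt E Z A) :
    push E a (δ + δ') = push E a δ + push E a δ' := map_add _ _ _

lemma pull_add {Z Z' A : C} (c : Z' ⟶ Z) (δ δ' : Elt E Z A) :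
    pull E c (δ + δ') = pull E c δ + pull E c δ' := map_add _ _ _

end Bifunctor

namespace ExtriangulatedStructure

variable {C : Type u} [Category.{v} C] [Preadditive C] [HasZeroObject C] [HasBinaryBiproducts C]
  (T : ExtriangulatedStructure.{w} C)

lemma zero_push {Z A A' : C} (δ : Elt T.E Z A) : push T.E (0 : A ⟶ A') δ = 0 := by
  have := T.additive_right (op Z)
  simp [push]

lemma zero_pull {Z Z' A : C} (δ : Elt T.E Z A) : pull T.E (0 : Z' ⟶ Z) δ = 0 := by
  have := T.additive_left
  simp [pull]

variable {T}

/-! ### Exact sequences attached to an `𝔼`-triangle -/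

section Exact

variable {A B Z : C} {δ : Elt T.E Z A} {x : A ⟶ B} {y : B ⟶ Z}

lemma pull_deflation (h : T.Realizes δ x y) : pull T.E y δ = 0 := by
  obtain ⟨c, hc, hc'⟩ := T.et3 _ _ _ _ _ _ (𝟙 A) (biprod.desc x (𝟙 B)) (T.realizes_zero B A) h
    (by simp)
  have : c = y := by simpa using biprod.inr ≫= hc'
  subst this
  rw [← hc, push_zero]

lemma inflation_comp_deflation (h : T.Realizes δ x y) : x ≫ y = 0 := by
  obtain ⟨c, -, hc⟩ := T.et3 _ _ _ _ _ _ (𝟙 A) (biprod.desc x (𝟙 B)) (T.realizes_zero B A) h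
    (by simp)
  simpa using (biprod.inl ≫= hc).symm

lemma push_inflation (h : T.Realizes δ x y) : push T.E x δ = 0 := by
  obtain ⟨a, ha, ha'⟩ := T.et3_op _ _ _ _ _ _ (biprod.lift (𝟙 B) y) (𝟙 Z) h
    (T.realizes_zero Z B) (by simp)
  have : x = a := by simpa using ha' =≫ biprod.fst
  subst this
  rw [ha, pull_zero]

lemma lift_of_pull_eq_zero (h : T.Realizes δ x y) {Q : C} (c : Q ⟶ Z) (hc : pull T.E c δ = 0) :
    ∃ b : Q ⟶ B, b ≫ y = c := by
  obtain ⟨b, -, hb⟩ := T.realize_hom _ _ _ _ _ _ (𝟙 A) c (T.realizes_zero Q A) h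
    (by rw [hc, push_zero])
  exact ⟨biprod.inr ≫ b, by simpa using (biprod.inr ≫= hb).symm⟩

lemma desc_of_push_eq_zero (h : T.Realizes δ x y) {Q : C} (a : A ⟶ Q) (ha : push T.E a δ = 0) :
    ∃ b : B ⟶ Q, x ≫ b = a := by
  obtain ⟨b, hb, -⟩ := T.realize_hom _ _ _ _ _ _ a (𝟙 Z) h (T.realizes_zero Z Q)
    (by rw [ha, pull_zero])
  exact ⟨b ≫ biprod.fst, by simpa using hb =≫ biprod.fst⟩

lemma exists_pull_of_push_eq_zero (h : T.Realizes δ x y) {Q : C} (e : Elt T.E Q A)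
    (he : push T.E x e = 0) : ∃ c : Q ⟶ Z, pull T.E c δ = e := by
  obtain ⟨B', x', y', h'⟩ := T.exists_realizes e
  obtain ⟨b, hb⟩ := desc_of_push_eq_zero h' x he
  obtain ⟨c, hc, -⟩ := T.et3 _ _ _ _ _ _ (𝟙 A) b h' h (by simpa using hb)
  exact ⟨c, by rw [← hc, push_id]⟩

lemma exists_push_of_pull_eq_zero (h : T.Realizes δ x y) {Q : C} (e : Elt T.E Z Q)
    (he : pull T.E y e = 0) : ∃ a : A ⟶ Q, push T.E a δ = e := by
  obtain ⟨B', x', y', h'⟩ := T.exists_realizes e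
  obtain ⟨b, hb⟩ := lift_of_pull_eq_zero h' y he
  obtain ⟨a, ha, -⟩ := T.et3_op _ _ _ _ _ _ b (𝟙 Z) h h' (by simpa using hb.symm)
  exact ⟨a, by rw [ha, pull_id]⟩

lemma exists_section_of_realizes_zero (h : T.Realizes (0 : Elt T.E Z A) x y) :
    ∃ s : Z ⟶ B, s ≫ y = 𝟙 Z :=
  lift_of_pull_eq_zero h (𝟙 Z) (pull_zero _ _)

lemma exists_retraction_of_realizes_zero (h : T.Realizes (0 : Elt T.E Z A) x y) :
    ∃ r : B ⟶ A, x ≫ r = 𝟙 A :=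
  desc_of_push_eq_zero h (𝟙 A) (push_zero _ _)

/-- (ET4) gives an extension `δ''` whose push along `x` is the pullback of `e` to a middle term of
`y_* e`. Since `y_* e = 0`, a section of that deflation brings the identity back to `Q`. -/
lemma exists_eq_push_inflation (h : T.Realizes δ x y) {Q : C} (e : Elt T.E Q B)
    (he : push T.E y e = 0) : ∃ e' : Elt T.E Q A, push T.E x e' = e := by
  obtain ⟨X, g, g', hg⟩ := T.exists_realizes e
  obtain ⟨Y, h', d, p, δ'', -, -, -, hr, -, hp⟩ := T.et4 _ _ _ _ _ _ h hg
  rw [he] at hr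
  obtain ⟨s, hs⟩ := exists_section_of_realizes_zero hr
  exact ⟨pull T.E s δ'', by rw [push_pull, hp, ← pull_comp, hs, pull_id]⟩

lemma exists_eq_pull_deflation (h : T.Realizes δ x y) {Q : C} (e : Elt T.E B Q)
    (he : pull T.E x e = 0) : ∃ e' : Elt T.E Z Q, pull T.E y e' = e := by
  obtain ⟨X, g', g, hg⟩ := T.exists_realizes e
  obtain ⟨Y, h', d, p, δ'', -, -, -, hr, -, hp⟩ := T.et4_op _ _ _ _ _ _ h hg
  rw [he] at hr
  obtain ⟨s, hs⟩ := exists_retraction_of_realizes_zero hr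
  exact ⟨push T.E s δ'', by rw [← push_pull, hp, ← push_comp, hs, push_id]⟩

end Exact

/-! ### Composition, pullback, pushout and horseshoe for triangles -/

section Triangles

variable {A B Z : C}

lemma Triangle.exists_realizes (h : T.Triangle A B Z) :
    ∃ (δ : Elt T.E Z A) (x : A ⟶ B) (y : B ⟶ Z), T.Realizes δ x y := by
  obtain ⟨x, y, δ, h⟩ := h
  exact ⟨δ, x, y, h⟩

lemma triangle_of_realizes {δ : Elt T.E Z A} {x : A ⟶ B} {y : B ⟶ Z} (h : T.Realizes δ x y) :
    T.Triangle A B Z := ⟨x, y, δ, h⟩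

lemma Triangle.of_iso_mid {B' : C} (h : T.Triangle A B Z) (e : B ≅ B') : T.Triangle A B' Z := by
  obtain ⟨δ, x, y, h⟩ := h.exists_realizes
  exact triangle_of_realizes
    (T.realizes_of_equiv δ x y e (x ≫ e.hom) (e.inv ≫ y) h rfl (by simp))

lemma Realizes.unique {B' : C} {δ : Elt T.E Z A} {x : A ⟶ B} {y : B ⟶ Z} {x' : A ⟶ B'}
    {y' : B' ⟶ Z} (h : T.Realizes δ x y) (h' : T.Realizes δ x' y') : Nonempty (B ≅ B') :=
  ⟨(T.equiv_of_realizes _ _ _ _ _ h h').choose⟩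

variable (T) in
lemma triangle_biprod (A Z : C) : T.Triangle A (A ⊞ Z) Z :=
  triangle_of_realizes (T.realizes_zero Z A)

/-- A split triangle. -/
lemma Triangle.iso_biprod (h : T.Triangle A B Z) (h0 : ∀ e : Elt T.E Z A, e = 0) :
    Nonempty (B ≅ A ⊞ Z) := by
  obtain ⟨δ, x, y, h⟩ := h.exists_realizes
  obtain rfl := h0 δ
  exact Realizes.unique h (T.realizes_zero Z A)

variable (T) in
lemma triangle_zero_left (A : C) {O : C} (hO : IsZero O) : T.Triangle O A A :=
  (T.triangle_biprod O A).of_iso_mid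
    ⟨biprod.snd, biprod.inr,
      by apply biprod.hom_ext' <;> [exact hO.eq_of_src _ _; simp], by simp⟩

/-- The cone of a composite of inflations. -/
lemma Triangle.comp_inflation {D X F : C} (h : T.Triangle A B D) (h' : T.Triangle B X F) :
    ∃ Y, T.Triangle A X Y ∧ T.Triangle D Y F := by
  obtain ⟨δ, x, y, h⟩ := h.exists_realizes
  obtain ⟨δ', x', y', h'⟩ := h'.exists_realizes
  obtain ⟨Y, _, _, _, _, h1, -, -, h2, -⟩ := T.et4 _ _ _ _ _ _ h h'
  exact ⟨Y, triangle_of_realizes h1, triangle_of_realizes h2⟩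

/-- The cocone of a composite of deflations. -/
lemma Triangle.comp_deflation {D X F : C} (h : T.Triangle D B A) (h' : T.Triangle F X B) :
    ∃ Y, T.Triangle Y X A ∧ T.Triangle F Y D := by
  obtain ⟨δ, x, y, h⟩ := h.exists_realizes
  obtain ⟨δ', x', y', h'⟩ := h'.exists_realizes
  obtain ⟨Y, _, _, _, _, h1, -, -, h2, -⟩ := T.et4_op _ _ _ _ _ _ h h'
  exact ⟨Y, triangle_of_realizes h1, triangle_of_realizes h2⟩

lemma desc_deflation {δ : Elt T.E Z A} {x : A ⟶ B} {y : B ⟶ Z} (h : T.Realizes δ x y) {Q : C}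
    (f : B ⟶ Q) (hf : x ≫ f = 0) : ∃ g : Z ⟶ Q, y ≫ g = f := by
  obtain ⟨c, -, hc⟩ := T.et3 _ _ _ _ _ _ (0 : A ⟶ Z) (f ≫ biprod.inr) h
    (T.realizes_zero Q Z) (by rw [reassoc_of% hf]; simp)
  exact ⟨c, by simpa using hc⟩

/-- The difference `b - 1` factors through `y` and squares to zero. This plays the role of the five
lemma when triangles are transported along isomorphisms of an end term. -/
lemma isIso_of_comp_eq {δ : Elt T.E Z A} {x : A ⟶ B} {y : B ⟶ Z} (h : T.Realizes δ x y)
    (b : B ⟶ B) (hx : x ≫ b = x) (hy : b ≫ y = y) : IsIso b := by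
  obtain ⟨g, hg⟩ := desc_deflation h (b - 𝟙 B) (by simp [hx])
  have hb : b = 𝟙 B + y ≫ g := by rw [hg]; abel
  have h0 : (y ≫ g) ≫ (y ≫ g) = 0 := by
    rw [← Category.assoc (y ≫ g), hg, Preadditive.sub_comp, hy]; simp
  refine ⟨𝟙 B - y ≫ g, ?_, ?_⟩ <;> subst hb <;>
    simp only [Preadditive.add_comp, Preadditive.comp_add, Preadditive.sub_comp,
      Preadditive.comp_sub, h0, Category.id_comp, Category.comp_id] <;> abel

lemma Triangle.of_iso_right {Z' : C} (h : T.Triangle A B Z) (i : Z ≅ Z') : T.Triangle A B Z' := by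
  obtain ⟨δ, x, y, h⟩ := h.exists_realizes
  obtain ⟨B', x', y', h'⟩ := T.exists_realizes (pull T.E i.inv δ)
  obtain ⟨b, hb1, hb2⟩ := T.realize_hom _ _ _ _ _ _ (𝟙 A) i.inv h' h (by rw [push_id])
  obtain ⟨b', hb1', hb2'⟩ := T.realize_hom _ _ _ _ _ _ (𝟙 A) i.hom h h'
    (by rw [push_id, ← pull_comp, i.hom_inv_id, pull_id])
  rw [Category.id_comp] at hb1 hb1'
  have h1 : IsIso (b ≫ b') := isIso_of_comp_eq h' _ (by rw [reassoc_of% hb1, hb1'])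
    (by rw [Category.assoc, ← hb2', ← reassoc_of% hb2]; simp)
  have h2 : IsIso (b' ≫ b) := isIso_of_comp_eq h _ (by rw [reassoc_of% hb1', hb1])
    (by rw [Category.assoc, ← hb2, ← reassoc_of% hb2']; simp)
  have : IsSplitMono b := .mk' ⟨b' ≫ inv (b ≫ b'), by rw [← Category.assoc, IsIso.hom_inv_id]⟩
  have : Epi b := epi_of_epi b' b
  have : IsIso b := isIso_of_epi_of_isSplitMono b
  exact (triangle_of_realizes h').of_iso_mid (asIso b)

/-- Lifting an extension of `F` by `D` along a deflation `B ⟶ D`. -/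
lemma triangle_of_push {D F X Y : C} {δ : Elt T.E D A} {f : A ⟶ B} {f' : B ⟶ D}
    (h : T.Realizes δ f f') {e : Elt T.E F B} {g : B ⟶ X} {g' : X ⟶ F} (hg : T.Realizes e g g')
    {d : D ⟶ Y} {p : Y ⟶ F} (hd : T.Realizes (push T.E f' e) d p) : T.Triangle A X Y := by
  obtain ⟨Y', h', _, _, δ'', h1, -, -, h2, -⟩ := T.et4 _ _ _ _ _ _ h hg
  exact (triangle_of_realizes h1).of_iso_right (Realizes.unique h2 hd).some

lemma triangle_of_push_fst {A₁ A₂ X Z B : C} {e : Elt T.E Z (A₁ ⊞ A₂)} {g : A₁ ⊞ A₂ ⟶ X}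
    {g' : X ⟶ Z} (hg : T.Realizes e g g') {x : A₁ ⟶ B} {y : B ⟶ Z}
    (h : T.Realizes (push T.E biprod.fst e) x y) : T.Triangle A₂ X B := by
  refine triangle_of_push (f := (biprod.inr : A₂ ⟶ A₁ ⊞ A₂)) (f' := biprod.fst) (δ := 0) ?_ hg h
  exact T.realizes_of_equiv _ _ _ (biprod.braiding A₂ A₁) _ _ (T.realizes_zero A₁ A₂)
    (by apply biprod.hom_ext <;> simp) (by simp)

lemma triangle_of_push_snd {A₁ A₂ X Z B : C} {e : Elt T.E Z (A₁ ⊞ A₂)} {g : A₁ ⊞ A₂ ⟶ X}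
    {g' : X ⟶ Z} (hg : T.Realizes e g g') {x : A₂ ⟶ B} {y : B ⟶ Z}
    (h : T.Realizes (push T.E biprod.snd e) x y) : T.Triangle A₁ X B :=
  triangle_of_push (T.realizes_zero A₂ A₁) hg h

/-- The homotopy pullback of two deflations. -/
lemma Triangle.pullback {A₁ B₁ A₂ B₂ Z : C} (h₁ : T.Triangle A₁ B₁ Z) (h₂ : T.Triangle A₂ B₂ Z) :
    ∃ N, T.Triangle A₁ N B₂ ∧ T.Triangle A₂ N B₁ := by
  obtain ⟨δ₁, x₁, y₁, h₁⟩ := h₁.exists_realizes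
  obtain ⟨δ₂, x₂, y₂, h₂⟩ := h₂.exists_realizes
  obtain ⟨N, g, g', hg⟩ := T.exists_realizes
    (push T.E biprod.inl δ₁ + push T.E biprod.inr δ₂ : Elt T.E Z (A₁ ⊞ A₂))
  refine ⟨N, triangle_of_push_snd hg (x := x₂) (y := y₂) ?_,
    triangle_of_push_fst hg (x := x₁) (y := y₁) ?_⟩
  · rwa [push_add, ← push_comp, ← push_comp, biprod.inl_snd, biprod.inr_snd, zero_push, push_id,
      zero_add]
  · rwa [push_add, ← push_comp, ← push_comp, biprod.inl_fst, biprod.inr_fst, zero_push, push_id,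
      add_zero]

lemma Triangle.of_iso_left {A B Z A' : C} (h : T.Triangle A B Z) (i : A ≅ A') :
    T.Triangle A' B Z := by
  obtain ⟨δ, x, y, h⟩ := h.exists_realizes
  obtain ⟨B', x', y', h'⟩ := T.exists_realizes (push T.E i.hom δ)
  obtain ⟨b, hb1, hb2⟩ := T.realize_hom _ _ _ _ _ _ i.hom (𝟙 Z) h h' (by rw [pull_id])
  obtain ⟨b', hb1', hb2'⟩ := T.realize_hom _ _ _ _ _ _ i.inv (𝟙 Z) h' h
    (by rw [pull_id, ← push_comp, i.hom_inv_id, push_id])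
  rw [Category.comp_id] at hb2 hb2'
  have h1 : IsIso (b ≫ b') := isIso_of_comp_eq h _ (by rw [reassoc_of% hb1, hb1']; simp)
    (by rw [Category.assoc, ← hb2', ← hb2])
  have h2 : IsIso (b' ≫ b) := isIso_of_comp_eq h' _ (by rw [reassoc_of% hb1', hb1]; simp)
    (by rw [Category.assoc, ← hb2, ← hb2'])
  have : IsSplitMono b := .mk' ⟨b' ≫ inv (b ≫ b'), by rw [← Category.assoc, IsIso.hom_inv_id]⟩
  have : Epi b := epi_of_epi b' b
  have : IsIso b := isIso_of_epi_of_isSplitMono b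
  exact (triangle_of_realizes h').of_iso_mid (asIso b).symm

/-- Extending an extension of `D` by `A` along an inflation `D ⟶ B`. -/
lemma triangle_of_pull {A B D F X Y : C} {δ : Elt T.E A D} {f' : D ⟶ B} {f : B ⟶ A}
    (h : T.Realizes δ f' f) {e : Elt T.E B F} {g' : F ⟶ X} {g : X ⟶ B} (hg : T.Realizes e g' g)
    {p : F ⟶ Y} {d : Y ⟶ D} (hd : T.Realizes (pull T.E f' e) p d) : T.Triangle Y X A := by
  obtain ⟨Y', h', _, _, δ'', h1, -, -, h2, -⟩ := T.et4_op _ _ _ _ _ _ h hg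
  exact (triangle_of_realizes h1).of_iso_left (Realizes.unique h2 hd).some

/-- The homotopy pushout of two inflations. -/
lemma Triangle.pushout {A B₁ Z₁ B₂ Z₂ : C} (h₁ : T.Triangle A B₁ Z₁) (h₂ : T.Triangle A B₂ Z₂) :
    ∃ N, T.Triangle B₁ N Z₂ ∧ T.Triangle B₂ N Z₁ := by
  obtain ⟨δ₁, x₁, y₁, h₁⟩ := h₁.exists_realizes
  obtain ⟨δ₂, x₂, y₂, h₂⟩ := h₂.exists_realizes
  obtain ⟨N, g, g', hg⟩ := T.exists_realizes
    (pull T.E biprod.fst δ₁ + pull T.E biprod.snd δ₂ : Elt T.E (Z₁ ⊞ Z₂) A)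
  refine ⟨N, triangle_of_pull (f' := biprod.inl) (f := biprod.snd) (T.realizes_zero Z₂ Z₁) hg
    (p := x₁) (d := y₁) ?_, triangle_of_pull (f' := biprod.inr) (f := biprod.fst) (δ := 0)
    ?_ hg (p := x₂) (d := y₂) ?_⟩
  · rwa [pull_add, ← pull_comp, ← pull_comp, biprod.inl_fst, biprod.inl_snd, zero_pull, pull_id,
      add_zero]
  · exact T.realizes_of_equiv _ _ _ (biprod.braiding Z₂ Z₁) _ _ (T.realizes_zero Z₁ Z₂)
      (by apply biprod.hom_ext <;> simp) (by simp)
  · rwa [pull_add, ← pull_comp, ← pull_comp, biprod.inr_fst, biprod.inr_snd, zero_pull, pull_id,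
      zero_add]

/-- The horseshoe construction. -/
lemma Triangle.horseshoe {A B Z K₁ W₁ K₂ W₂ : C} (h : T.Triangle A B Z)
    (h₁ : T.Triangle K₁ W₁ A) (h₂ : T.Triangle K₂ W₂ Z)
    (hlift : ∀ (δ : Elt T.E A K₁) (x : K₁ ⟶ W₁) (y : W₁ ⟶ A), T.Realizes δ x y →
      ∀ e : Elt T.E W₂ A, ∃ e' : Elt T.E W₂ W₁, push T.E y e' = e) :
    ∃ K W, T.Triangle W₁ W W₂ ∧ T.Triangle K W B ∧ T.Triangle K₁ K K₂ := by
  obtain ⟨N, hN, hN'⟩ := h.pullback h₂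
  obtain ⟨δ, x, y, h₁⟩ := h₁.exists_realizes
  obtain ⟨e, d, p, hN⟩ := hN.exists_realizes
  -- The lifting hypothesis stands in for projectivity of `W₂`: the extension `N` of `W₂` by `A` is
  -- covered by one of `W₂` by `W₁`.
  obtain ⟨e', rfl⟩ := hlift δ x y h₁ e
  obtain ⟨W, g, g', hg⟩ := T.exists_realizes e'
  obtain ⟨K, hK, hK'⟩ := hN'.comp_deflation (triangle_of_push h₁ hg hN)
  exact ⟨K, W, triangle_of_realizes hg, hK, hK'⟩

end Triangles

/-! ### Dimension shifting for higher extensions -/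

section Vanishing

variable {A B Z : C}

lemma vanish_mid (h : T.Triangle A B Z) {Q : C} (hA : ∀ e : Elt T.E Q A, e = 0)
    (hZ : ∀ e : Elt T.E Q Z, e = 0) (e : Elt T.E Q B) : e = 0 := by
  obtain ⟨δ, x, y, h⟩ := h.exists_realizes
  obtain ⟨e', rfl⟩ := exists_eq_push_inflation h e (hZ _)
  rw [hA e', push_zero]

lemma vanish_mid' (h : T.Triangle A B Z) {Q : C} (hA : ∀ e : Elt T.E A Q, e = 0)
    (hZ : ∀ e : Elt T.E Z Q, e = 0) (e : Elt T.E B Q) : e = 0 := by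
  obtain ⟨δ, x, y, h⟩ := h.exists_realizes
  obtain ⟨e', rfl⟩ := exists_eq_pull_deflation h e (hA _)
  rw [hZ e', pull_zero]

lemma vanish_retract {X X' Q : C} (i : X ⟶ X') (r : X' ⟶ X) (hi : i ≫ r = 𝟙 X)
    (h : ∀ e : Elt T.E X' Q, e = 0) (e : Elt T.E X Q) : e = 0 := by
  rw [← pull_id T.E e, ← hi, pull_comp, h (pull T.E r e), pull_zero]

lemma vanish_of_isZero {Q O : C} (hO : IsZero O) (e : Elt T.E Q O) : e = 0 := by
  rw [← push_id T.E e, hO.eq_of_src (𝟙 O) 0, zero_push]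

lemma IsProjective.vanish {P : C} (hP : T.IsProjective P) {Q : C} (e : Elt T.E P Q) : e = 0 := by
  obtain ⟨B, x, y, h⟩ := T.exists_realizes e
  obtain ⟨s, hs⟩ := hP x y ⟨e, h⟩ (𝟙 P)
  rw [← pull_id T.E e, ← hs, pull_comp, pull_deflation h, pull_zero]

lemma IsInjective.vanish {I : C} (hI : T.IsInjective I) {Q : C} (e : Elt T.E Q I) : e = 0 := by
  obtain ⟨B, x, y, h⟩ := T.exists_realizes e
  obtain ⟨s, hs⟩ := hI.2 x y trivial trivial trivial ⟨e, h⟩ (𝟙 I)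
  rw [← push_id T.E e, ← hs, push_comp, push_inflation h, push_zero]

variable (T) in
lemma syzygy_triangle [T.HasEnoughProjectives] (Q : C) :
    ∃ P, T.IsProjective P ∧ T.Triangle (T.syzygy Q) P Q :=
  (HasEnoughProjectives.exists_triangle (T := T) Q).choose_spec

variable (T) in
/-- A chosen cosyzygy. -/
noncomputable def cosyzygy [T.HasEnoughInjectives] (Q : C) : C :=
  (HasEnoughInjectives.exists_triangle (T := T) Q).choose_spec.choose

variable (T) in
lemma cosyzygy_triangle [T.HasEnoughInjectives] (Q : C) :
    ∃ I, T.IsInjective I ∧ T.Triangle Q I (T.cosyzygy Q) :=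
  ⟨_, (HasEnoughInjectives.exists_triangle (T := T) Q).choose_spec.choose_spec⟩

section Proj

variable [T.HasEnoughProjectives]

lemma vanish_left (h : T.Triangle A B Z) {Q : C} (hZ : ∀ e : Elt T.E Q Z, e = 0)
    (hB : ∀ e : Elt T.E (T.syzygy Q) B, e = 0) (e : Elt T.E (T.syzygy Q) A) : e = 0 := by
  obtain ⟨δ, x, y, h⟩ := h.exists_realizes
  obtain ⟨P, hP, hQ⟩ := T.syzygy_triangle Q
  obtain ⟨θ, i, p, hQ⟩ := hQ.exists_realizes
  obtain ⟨f, rfl⟩ := exists_pull_of_push_eq_zero h e (hB _)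
  obtain ⟨g, rfl⟩ := desc_of_push_eq_zero hQ f (hZ _)
  rw [pull_comp, hP.vanish (pull T.E g δ), pull_zero]

lemma exists_push_eq {δ : Elt T.E Z A} {x : A ⟶ B} {y : B ⟶ Z} (h : T.Realizes δ x y) {Q : C}
    (hA : ∀ e : Elt T.E (T.syzygy Q) A, e = 0) (e : Elt T.E Q Z) :
    ∃ e' : Elt T.E Q B, push T.E y e' = e := by
  obtain ⟨P, hP, hQ⟩ := T.syzygy_triangle Q
  obtain ⟨θ, i, p, hQ⟩ := hQ.exists_realizes
  obtain ⟨f, rfl⟩ := exists_push_of_pull_eq_zero hQ e (hP.vanish _)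
  obtain ⟨g, rfl⟩ := lift_of_pull_eq_zero h f (hA _)
  exact ⟨push T.E g θ, by rw [push_comp]⟩

lemma vanish_right (h : T.Triangle A B Z) {Q : C} (hB : ∀ e : Elt T.E Q B, e = 0)
    (hA : ∀ e : Elt T.E (T.syzygy Q) A, e = 0) (e : Elt T.E Q Z) : e = 0 := by
  obtain ⟨δ, x, y, h⟩ := h.exists_realizes
  obtain ⟨e', rfl⟩ := exists_push_eq h hA e
  rw [hB e', push_zero]

end Proj

section Inj

variable [T.HasEnoughInjectives]

lemma vanish_right' (h : T.Triangle A B Z) {Q : C} (hA : ∀ e : Elt T.E A Q, e = 0)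
    (hB : ∀ e : Elt T.E B (T.cosyzygy Q), e = 0) (e : Elt T.E Z (T.cosyzygy Q)) : e = 0 := by
  obtain ⟨δ, x, y, h⟩ := h.exists_realizes
  obtain ⟨I, hI, hQ⟩ := T.cosyzygy_triangle Q
  obtain ⟨θ, i, p, hQ⟩ := hQ.exists_realizes
  obtain ⟨f, rfl⟩ := exists_push_of_pull_eq_zero h e (hB _)
  obtain ⟨g, rfl⟩ := lift_of_pull_eq_zero hQ f (hA _)
  rw [push_comp, hI.vanish (push T.E g δ), push_zero]

lemma vanish_left' (h : T.Triangle A B Z) {Q : C} (hB : ∀ e : Elt T.E B Q, e = 0)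
    (hZ : ∀ e : Elt T.E Z (T.cosyzygy Q), e = 0) (e : Elt T.E A Q) : e = 0 := by
  obtain ⟨δ, x, y, h⟩ := h.exists_realizes
  obtain ⟨I, hI, hQ⟩ := T.cosyzygy_triangle Q
  obtain ⟨θ, i, p, hQ⟩ := hQ.exists_realizes
  obtain ⟨f, rfl⟩ := exists_pull_of_push_eq_zero hQ e (hI.vanish _)
  obtain ⟨g, rfl⟩ := desc_of_push_eq_zero h f (hZ _)
  rw [pull_comp, hB (pull T.E g θ), pull_zero]

end Inj

section Higher

variable [T.HasEnoughProjectives] [T.HasEnoughInjectives]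

lemma vanish_syzygy_iff (X Y : C) :
    (∀ e : Elt T.E (T.syzygy X) Y, e = 0) ↔ ∀ e : Elt T.E X (T.cosyzygy Y), e = 0 := by
  obtain ⟨P, hP, hX⟩ := T.syzygy_triangle X
  obtain ⟨I, hI, hY⟩ := T.cosyzygy_triangle Y
  exact ⟨fun h => vanish_right hY (fun _ => hI.vanish _) h,
    fun h => vanish_left hY h (fun _ => hI.vanish _)⟩

end Higher

variable (T) in
/-- `𝔼^{i+1}(X, Y) = 0`. -/
def ExtVanish [T.HasEnoughProjectives] (i : ℕ) (X Y : C) : Prop := ∀ e : T.ExtSucc i X Y, e = 0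

section Proj

variable [T.HasEnoughProjectives] {i : ℕ} {Q : C}

lemma ExtVanish.mid (h : T.Triangle A B Z) (hA : T.ExtVanish i Q A) (hZ : T.ExtVanish i Q Z) :
    T.ExtVanish i Q B := vanish_mid h hA hZ

lemma ExtVanish.left (h : T.Triangle A B Z) (hZ : T.ExtVanish i Q Z)
    (hB : T.ExtVanish (i + 1) Q B) : T.ExtVanish (i + 1) Q A := vanish_left h hZ hB

lemma ExtVanish.right (h : T.Triangle A B Z) (hB : T.ExtVanish i Q B)
    (hA : T.ExtVanish (i + 1) Q A) : T.ExtVanish i Q Z := vanish_right h hB hA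

lemma extVanish_of_isZero {O : C} (hO : IsZero O) : T.ExtVanish i Q O := vanish_of_isZero hO

variable [T.HasEnoughInjectives]

/-- Higher extensions are defined by syzygies of the first variable, which suits covariant
sequences; trading them for cosyzygies of the second gives the contravariant ones. -/
lemma extVanish_iff (i : ℕ) (X Y : C) :
    T.ExtVanish i X Y ↔ ∀ e : Elt T.E X (T.cosyzygy^[i] Y), e = 0 := by
  induction i generalizing Y with
  | zero => rfl
  | succ i ih =>
    rw [Function.iterate_succ_apply, ← ih]
    exact vanish_syzygy_iff _ _

lemma ExtVanish.mid' (h : T.Triangle A B Z) (hA : T.ExtVanish i A Q) (hZ : T.ExtVanish i Z Q) :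
    T.ExtVanish i B Q := by
  rw [extVanish_iff] at *
  exact vanish_mid' h hA hZ

lemma ExtVanish.left' (h : T.Triangle A B Z) (hB : T.ExtVanish i B Q)
    (hZ : T.ExtVanish (i + 1) Z Q) : T.ExtVanish i A Q := by
  rw [extVanish_iff] at *
  rw [Function.iterate_succ_apply'] at hZ
  exact vanish_left' h hB hZ

lemma ExtVanish.right' (h : T.Triangle A B Z) (hA : T.ExtVanish i A Q)
    (hB : T.ExtVanish (i + 1) B Q) : T.ExtVanish (i + 1) Z Q := by
  rw [extVanish_iff] at *
  rw [Function.iterate_succ_apply'] at *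
  exact vanish_right' h hA hB

lemma ExtVanish.retract {X X' : C} (j : X ⟶ X') (r : X' ⟶ X) (hj : j ≫ r = 𝟙 X)
    (h : T.ExtVanish i X' Q) : T.ExtVanish i X Q := by
  rw [extVanish_iff] at *
  exact vanish_retract j r hj h

end Proj

end Vanishing

/-! ### Closure properties of `T.properRes 𝒞` -/

section ProperRes

variable [T.HasEnoughProjectives] {𝒞 : ObjectProperty C} {A B Z K W : C}

lemma properRes_le_rightPerp : T.properRes 𝒞 ≤ T.rightPerp 𝒞 := by
  rintro A ⟨K, W, rfl, h⟩
  exact (h 0).2.1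

lemma properRes.exists_triangle (hA : T.properRes 𝒞 A) :
    ∃ K W, 𝒞 W ∧ T.properRes 𝒞 K ∧ T.Triangle K W A := by
  obtain ⟨K, W, rfl, h⟩ := hA
  exact ⟨K 1, W 0, (h 0).1, ⟨fun n => K (n + 1), fun n => W (n + 1), rfl, fun n => h (n + 1)⟩,
    (h 0).2.2⟩

/-- Coinduction for `properRes`. -/
lemma le_properRes {P : ObjectProperty C} (h1 : P ≤ T.rightPerp 𝒞)
    (h2 : ∀ A, P A → ∃ K W, 𝒞 W ∧ P K ∧ T.Triangle K W A) : P ≤ T.properRes 𝒞 := by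
  intro A hA
  choose! K W hW hK hT using h2
  have hP : ∀ n, P (K^[n] A) := fun n => by
    induction n with
    | zero => exact hA
    | succ n ih => rw [Function.iterate_succ_apply']; exact hK _ ih
  refine ⟨fun n => K^[n] A, fun n => W (K^[n] A), rfl, fun n => ⟨hW _ (hP n), h1 _ (hP n), ?_⟩⟩
  simpa only [Function.iterate_succ_apply'] using hT _ (hP n)

lemma properRes_of_triangle (hA : T.rightPerp 𝒞 A) (hW : 𝒞 W) (hK : T.properRes 𝒞 K)
    (h : T.Triangle K W A) : T.properRes 𝒞 A := by
  refine le_properRes (P := fun B => B = A ∨ T.properRes 𝒞 B) ?_ ?_ A (Or.inl rfl)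
  · rintro B (rfl | hB)
    exacts [hA, properRes_le_rightPerp _ hB]
  · rintro B (rfl | hB)
    · exact ⟨K, W, hW, Or.inr hK, h⟩
    · obtain ⟨K', W', hW', hK', h'⟩ := hB.exists_triangle
      exact ⟨K', W', hW', Or.inr hK', h'⟩

lemma rightPerp.mid (h : T.Triangle A B Z) (hA : T.rightPerp 𝒞 A) (hZ : T.rightPerp 𝒞 Z) :
    T.rightPerp 𝒞 B := fun X hX i =>
  ExtVanish.mid (i := i) h (hA X hX i) (hZ X hX i)

lemma rightPerp.right (h : T.Triangle A B Z) (hA : T.rightPerp 𝒞 A) (hB : T.rightPerp 𝒞 B) :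
    T.rightPerp 𝒞 Z := fun X hX i =>
  ExtVanish.right (i := i) h (hB X hX i) (hA X hX (i + 1))

lemma SelfOrthogonal.extension (h𝒞 : IsSubcategory 𝒞) (hself : T.SelfOrthogonal 𝒞)
    (h : T.Triangle A B Z) (hA : 𝒞 A) (hZ : 𝒞 Z) : 𝒞 B := by
  obtain ⟨i⟩ := h.iso_biprod (hself A hA Z hZ 0)
  exact h𝒞.iso _ _ i.symm (h𝒞.biprod _ _ hA hZ)

lemma properRes.extension (h𝒞 : IsSubcategory 𝒞) (hself : T.SelfOrthogonal 𝒞)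
    (h : T.Triangle A B Z) (hA : T.properRes 𝒞 A) (hZ : T.properRes 𝒞 Z) :
    T.properRes 𝒞 B := by
  refine le_properRes (𝒞 := 𝒞) (P := fun B => ∃ A Z, T.Triangle A B Z ∧ T.properRes 𝒞 A ∧
    T.properRes 𝒞 Z) ?_ ?_ B ⟨A, Z, h, hA, hZ⟩
  · rintro B ⟨A, Z, h, hA, hZ⟩
    exact rightPerp.mid h (properRes_le_rightPerp _ hA) (properRes_le_rightPerp _ hZ)
  · rintro B ⟨A, Z, h, hA, hZ⟩
    obtain ⟨K₁, W₁, hW₁, hK₁, h₁⟩ := hA.exists_triangle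
    obtain ⟨K₂, W₂, hW₂, hK₂, h₂⟩ := hZ.exists_triangle
    obtain ⟨K, W, hW, hK, hK'⟩ := h.horseshoe h₁ h₂ fun δ x y hδ =>
      exists_push_eq hδ (properRes_le_rightPerp _ hK₁ W₂ hW₂ 1)
    exact ⟨K, W, hself.extension h𝒞 hW hW₁ hW₂, ⟨K₁, K₂, hK', hK₁, hK₂⟩, hK⟩

/-- For a resolving triangle `K ⟶ W ⟶ B`, the cocone of `W ⟶ B ⟶ Z` is an extension of `A` by `K`,
which serves as a first syzygy of `Z`. -/
lemma properRes.cone (h𝒞 : IsSubcategory 𝒞) (hself : T.SelfOrthogonal 𝒞)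
    (h : T.Triangle A B Z) (hA : T.properRes 𝒞 A) (hB : T.properRes 𝒞 B) :
    T.properRes 𝒞 Z := by
  obtain ⟨K, W, hW, hK, h'⟩ := hB.exists_triangle
  obtain ⟨L, hL, hL'⟩ := h.comp_deflation h'
  exact properRes_of_triangle
    (rightPerp.right h (properRes_le_rightPerp _ hA) (properRes_le_rightPerp _ hB)) hW
    (hK.extension h𝒞 hself hL' hA) hL

end ProperRes

/-! ### Left minimal approximations and Wakamatsu's lemma -/

section Approximation

variable {M : C} {D : ObjectProperty C}

variable (T) in
lemma isInflation_id (A : C) : T.IsInflation (𝟙 A) := by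
  obtain ⟨O, hO⟩ : ∃ O : C, IsZero O := ⟨_, isZero_zero C⟩
  exact ⟨O, 0, 0, T.realizes_of_equiv _ _ _ ⟨biprod.fst, biprod.inl,
      by apply biprod.hom_ext' <;> [simp; exact hO.eq_of_src _ _], by simp⟩ _ _
      (T.realizes_zero O A) (by simp) (hO.eq_of_tgt _ _)⟩

lemma WIC.of_retract (hWIC : T.WIC) (hD : IsSubcategory D) {W W' : C} (s : W' ⟶ W) (r : W ⟶ W')
    (hs : s ≫ r = 𝟙 W') (hW : D W) : D W' := by
  obtain ⟨Z, y, δ, h⟩ := hWIC.1 s r (by rw [hs]; exact T.isInflation_id W')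
  obtain rfl : δ = 0 := by
    rw [← push_id T.E δ, ← hs, push_comp, push_inflation h, push_zero]
  exact hD.summand _ _ (hD.iso _ _ (Realizes.unique h (T.realizes_zero Z W')).some hW)

instance hasFiniteBiproducts_of_hasBinaryBiproducts : HasFiniteBiproducts C := by
  have := hasFiniteProducts_of_has_binary_and_terminal (C := C)
  exact HasFiniteBiproducts.of_hasFiniteProducts

/-- If some non-invertible `h` fixes `g`, then `1 - h` is not radical, so it detects a local summand
`f i` on which `g` is redundant. Dropping it lowers the number of summands. -/
lemma exists_left_minimal_approx_of_biproduct (hWIC : T.WIC) (hD : IsSubcategory D) (n : ℕ) :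
    ∀ (J : Type) [Fintype J], Fintype.card J = n → ∀ (f : J → C),
      (∀ j, IsLocalRing (End (f j))) → ∀ g : M ⟶ ⨁ f, T.IsInflation g → IsLeftApprox D g →
      ∃ (W : C) (g : M ⟶ W), T.IsInflation g ∧ IsLeftApprox D g ∧
        ∀ h : W ⟶ W, g ≫ h = g → IsIso h := by
  classical
  induction n using Nat.strong_induction_on with
  | _ n ih =>
  intro J _ hJ f hf g hg hgD
  by_cases H : ∀ h : (⨁ f) ⟶ (⨁ f), g ≫ h = g → IsIso h
  · exact ⟨_, g, hg, hgD, H⟩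
  push Not at H
  obtain ⟨h, hgh, hh⟩ := H
  obtain ⟨i, t, hit⟩ : ∃ i, ∃ t : (⨁ f) ⟶ f i,
      ¬ IsIso (𝟙 (f i) - (biproduct.ι f i ≫ (𝟙 _ - h)) ≫ t) := by
    by_contra! H
    refine hh ?_
    have := isIso_one_sub_sum Finset.univ f (biproduct.π f)
      (fun j => biproduct.ι f j ≫ (𝟙 _ - h)) H
    simp_rw [← Category.assoc] at this
    rwa [← Preadditive.sum_comp, biproduct.total, Category.id_comp, sub_sub_cancel] at this
  have hu : IsIso (biproduct.ι f i ≫ (𝟙 _ - h) ≫ t) := by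
    have := hf i
    rw [← isUnit_iff_isIso]
    refine (IsLocalRing.isUnit_or_isUnit_of_add_one (R := End (f i))
      (a := (biproduct.ι f i ≫ (𝟙 _ - h) ≫ t : End (f i)))
      (b := (𝟙 (f i) - (biproduct.ι f i ≫ (𝟙 _ - h)) ≫ t : End (f i))) ?_).resolve_right ?_
    · rw [Category.assoc]; exact add_sub_cancel _ _
    · rwa [isUnit_iff_isIso]
  set r := (𝟙 _ - h) ≫ t ≫ inv (biproduct.ι f i ≫ (𝟙 _ - h) ≫ t)
  have hr : biproduct.ι f i ≫ r = 𝟙 _ := by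
    have := IsIso.hom_inv_id (biproduct.ι f i ≫ (𝟙 _ - h) ≫ t)
    simpa only [r, Category.assoc] using this
  have hgr : g ≫ r = 0 := by
    have : g ≫ (𝟙 _ - h) = 0 := by simp [hgh]
    simp only [r, reassoc_of% this, zero_comp]
  let p : J → Prop := fun j => j ≠ i
  -- As `ι i ≫ r = 1` and `g ≫ r = 0`, the idempotent `1 - r ≫ ι i` fixes `g` and kills `f i`; hence
  -- `s` recovers `g` from `g ≫ q`.
  let q := biproduct.toSubtype f p
  let s : (⨁ Subtype.restrict p f) ⟶ ⨁ f :=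
    biproduct.fromSubtype f p ≫ (𝟙 _ - r ≫ biproduct.ι f i)
  have hq : q ≫ biproduct.fromSubtype f p = 𝟙 _ - biproduct.π f i ≫ biproduct.ι f i := by
    rw [biproduct.toSubtype_fromSubtype]
    apply biproduct.hom_ext'
    intro j
    by_cases hj : j = i
    · subst hj
      simp [p, Preadditive.comp_sub]
    · simp [p, hj, Preadditive.comp_sub, biproduct.ι_π_ne_assoc _ hj]
  have hgs : (g ≫ q) ≫ s = g := by
    have h1 : (𝟙 _ - biproduct.π f i ≫ biproduct.ι f i) ≫ (𝟙 _ - r ≫ biproduct.ι f i) =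
        𝟙 _ - r ≫ biproduct.ι f i := by
      simp [Preadditive.sub_comp, Preadditive.comp_sub, reassoc_of% hr]
    calc (g ≫ q) ≫ s = g ≫ (q ≫ biproduct.fromSubtype f p) ≫ (𝟙 _ - r ≫ biproduct.ι f i) := by
          simp [s]
      _ = g := by rw [hq, h1, Preadditive.comp_sub, reassoc_of% hgr]; simp
  refine ih (Fintype.card {j // p j}) ?_ _ rfl (Subtype.restrict p f) (fun j => hf j) (g ≫ q)
    (hWIC.1 (g ≫ q) s (by rwa [hgs])) ⟨?_, fun W' hW' k => ?_⟩
  · rw [← hJ]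
    exact Fintype.card_subtype_lt (x := i) (by simp [p])
  · exact hWIC.of_retract hD (biproduct.fromSubtype f p) q
      (biproduct.fromSubtype_toSubtype f p) hgD.1
  · obtain ⟨l, rfl⟩ := hgD.2 W' hW' k
    exact ⟨s ≫ l, by rw [← Category.assoc, hgs]⟩

/-- Wakamatsu's lemma: in the Krull-Schmidt case, an inflation which is a left approximation can
be chosen with cone `V` such that `𝔼(V, D) = 0`. -/
lemma exists_special_left_approx (hKS : IsKrullSchmidt C) (hWIC : T.WIC) (hD : IsSubcategory D)
    (hext : ∀ A B Z : C, T.Triangle A B Z → D A → D Z → D B)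
    {W : C} (g : M ⟶ W) (hg : T.IsInflation g) (hgD : IsLeftApprox D g) :
    ∃ W V, T.Triangle M W V ∧ D W ∧ ∀ W', D W' → ∀ e : Elt T.E V W', e = 0 := by
  obtain ⟨n, f, b, hf, ⟨hb⟩, ⟨i⟩⟩ := hKS W
  let j : W ≅ ⨁ f := i ≪≫ biproduct.uniqueUpToIso f hb
  obtain ⟨W, g, ⟨V, y, δ, h⟩, hgD, hmin⟩ :=
    exists_left_minimal_approx_of_biproduct hWIC hD n (Fin n) (Fintype.card_fin n) f hf
      (g ≫ j.hom) (hWIC.1 _ j.inv (by simpa using hg))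
      ⟨hD.iso _ _ j hgD.1, fun W' hW' k => by
        obtain ⟨l, rfl⟩ := hgD.2 W' hW' k
        exact ⟨j.inv ≫ l, by simp⟩⟩
  refine ⟨W, V, triangle_of_realizes h, hgD.1, fun W' hW' e => ?_⟩
  -- Then `e` is a push of `δ` along some `a : M ⟶ W'`, and `a` factors through `g`, which kills
  -- `δ`.
  suffices pull T.E y e = 0 by
    obtain ⟨a, rfl⟩ := exists_push_of_pull_eq_zero h e this
    obtain ⟨l, rfl⟩ := hgD.2 W' hW' a
    rw [push_comp, push_inflation h, push_zero]
  obtain ⟨Q, x', q, hq⟩ := T.exists_realizes (pull T.E y e)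
  -- The middle term `Q` lies in `D`, so the lift `m` of `g` extends to `k : W ⟶ Q`. Now `k ≫ q`
  -- fixes `g`, hence is invertible by minimality, and `q` splits.
  obtain ⟨m, hm⟩ := lift_of_pull_eq_zero hq g (by
    rw [← pull_comp, inflation_comp_deflation h, zero_pull])
  obtain ⟨k, rfl⟩ := hgD.2 Q (hext _ _ _ (triangle_of_realizes hq) hW' hgD.1) m
  have := hmin (k ≫ q) (by rw [← Category.assoc, hm])
  rw [← pull_id T.E (pull T.E y e), ← IsIso.inv_hom_id (k ≫ q), pull_comp, pull_comp T.E k q,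
    pull_deflation hq, pull_zero, pull_zero]

end Approximation

/-! ### Finite coresolutions and relative dimension -/

variable {𝒞 D : ObjectProperty C}

lemma check_le_check {P Q : ObjectProperty C} (h : P ≤ Q) : T.check P ≤ T.check Q := by
  rintro A ⟨n, hA⟩
  refine ⟨n, ?_⟩
  induction n generalizing A with
  | zero => exact h _ hA
  | succ n ih =>
    obtain ⟨W, K, hW, hK, hT⟩ := hA
    exact ⟨W, K, h _ hW, ih _ hK, hT⟩

lemma check_of_triangle {P : ObjectProperty C} {A W K : C} (hW : P W) (hK : T.check P K)
    (h : T.Triangle A W K) : T.check P A := by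
  obtain ⟨n, hK⟩ := hK
  exact ⟨n + 1, W, K, hW, hK, h⟩

section Dimension

variable [T.HasEnoughProjectives]

variable (T) in
/-- `V` has projective dimension at most `n` relative to `P`. -/
def DimLE (P : ObjectProperty C) (n : ℕ) (V : C) : Prop :=
  ∀ i, n ≤ i → ∀ Y, P Y → T.ExtVanish i V Y

lemma DimLE.mono {P : ObjectProperty C} {m n : ℕ} {V : C} (h : T.DimLE P m V) (hmn : m ≤ n) :
    T.DimLE P n V := fun i hi => h i (hmn.trans hi)

lemma extVanish_of_checkN {n : ℕ} {S V : C} (hS : T.checkN D n S) (hV : T.leftPerp D V) :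
    ∀ i, n ≤ i → T.ExtVanish i V S := by
  induction n generalizing S with
  | zero => exact fun i _ => hV S hS i
  | succ n ih =>
    obtain ⟨W, K, hW, hK, h⟩ := hS
    rintro (_ | i) hi
    · omega
    · exact ExtVanish.left h (ih hK i (by omega)) (hV W hW (i + 1))

lemma HasFiltration.extVanish {S : Set C} {M V : C} (hM : T.HasFiltration S M) {i : ℕ}
    (h : ∀ Q ∈ S, T.ExtVanish i V Q) : T.ExtVanish i V M := by
  induction hM with
  | base O M Q hO hQ hT => exact ExtVanish.mid hT (extVanish_of_isZero hO) (h Q hQ)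
  | step M' M Q _ hQ hT ih => exact ExtVanish.mid hT ih (h Q hQ)

variable (T) in
/-- `M` is the end of a triangle `W ⟶ U ⟶ M` with `W ∈ D` and `U ∈ ^⊥D` of relative projective
dimension at most `n`. -/
def HasPrecover (D X : ObjectProperty C) (n : ℕ) (M : C) : Prop :=
  ∃ W U, T.Triangle W U M ∧ D W ∧ T.leftPerp D U ∧ T.DimLE X n U

lemma HasPrecover.mono {X : ObjectProperty C} {m n : ℕ} {M : C} (h : T.HasPrecover D X m M)
    (hmn : m ≤ n) : T.HasPrecover D X n M := by
  obtain ⟨W, U, hT, hW, hU, hd⟩ := h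
  exact ⟨W, U, hT, hW, hU, hd.mono hmn⟩

lemma checkN_of_extVanish (hD : IsSubcategory D)
    (henv : ∀ M, T.properRes 𝒞 M →
      ∃ W V, T.Triangle M W V ∧ D W ∧ T.leftPerp D V ∧ T.properRes 𝒞 V)
    {n : ℕ} {M : C} (hM : T.properRes 𝒞 M)
    (h : ∀ V, T.leftPerp D V → T.properRes 𝒞 V → ∀ i, n ≤ i → T.ExtVanish i V M) :
    T.checkN D n M := by
  induction n generalizing M with
  | zero =>
    obtain ⟨W, V, hT, hW, hV, hV'⟩ := henv M hM
    obtain ⟨i⟩ := hT.iso_biprod (h V hV hV' 0 le_rfl)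
    exact hD.summand _ _ (hD.iso _ _ i hW)
  | succ n ih =>
    obtain ⟨W, V, hT, hW, hV, hV'⟩ := henv M hM
    exact ⟨W, V, hW, ih hV' fun V₁ hV₁ hV₁' i hi =>
      ExtVanish.right hT (hV₁ W hW i) (h V₁ hV₁ hV₁' (i + 1) (by omega)), hT⟩

/-- `({_𝒞𝒳})ˇ_n` is closed under extensions by objects of `_𝒞𝒳`. -/
lemma checkN_extension (h𝒞 : IsSubcategory 𝒞) (hself : T.SelfOrthogonal 𝒞) {n : ℕ} {A B Z : C}
    (h : T.Triangle A B Z) (hA : T.checkN (T.properRes 𝒞) n A) (hZ : T.properRes 𝒞 Z) :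
    T.checkN (T.properRes 𝒞) n B := by
  cases n with
  | zero => exact properRes.extension h𝒞 hself h hA hZ
  | succ n =>
    obtain ⟨X₀, K, hX₀, hK, hT⟩ := hA
    obtain ⟨N, hN, hN'⟩ := h.pushout hT
    exact ⟨N, K, hX₀.extension h𝒞 hself hN' hZ, hK, hN⟩

/-- Replacing the first term `X₀` by its preenvelope `W` in `D` changes the cosyzygy `M'` into an
extension of `V` by `M'`, whose coresolution is no longer than that of `M'`. -/
lemma check_le_check_of_properRes_le (h𝒞 : IsSubcategory 𝒞) (hself : T.SelfOrthogonal 𝒞)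
    (henv : ∀ M, T.properRes 𝒞 M →
      ∃ W V, T.Triangle M W V ∧ D W ∧ T.leftPerp D V ∧ T.properRes 𝒞 V)
    (hle : T.properRes 𝒞 ≤ T.check D) : T.check (T.properRes 𝒞) ≤ T.check D := by
  rintro M ⟨n, hM⟩
  induction n generalizing M with
  | zero => exact hle M hM
  | succ n ih =>
    obtain ⟨X₀, M', hX₀, hM', h⟩ := hM
    obtain ⟨W, V, hT, hW, -, hV⟩ := henv X₀ hX₀
    obtain ⟨L, hL, hL'⟩ := h.comp_inflation hT
    exact check_of_triangle hW (ih _ (checkN_extension h𝒞 hself hL' hM' hV)) hL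

variable [T.HasEnoughInjectives]

lemma DimLE.of_hatN {n : ℕ} {V : C} (hV : T.hatN 𝒞 n V) : T.DimLE (T.rightPerp 𝒞) n V := by
  induction n generalizing V with
  | zero => exact fun i _ Y hY => hY V hV i
  | succ n ih =>
    obtain ⟨K, W, hW, hK, h⟩ := hV
    rintro (_ | i) hi Y hY
    · omega
    · exact ExtVanish.right' h (ih hK i (by omega) Y hY) (hY W hW (i + 1))

lemma hatN_of_dimLE (h𝒞 : IsSubcategory 𝒞) {n : ℕ} {V : C} (hV : T.properRes 𝒞 V)
    (h : T.DimLE (T.properRes 𝒞) n V) : T.hatN 𝒞 n V := by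
  induction n generalizing V with
  | zero =>
    obtain ⟨K, W, hW, hK, hT⟩ := hV.exists_triangle
    obtain ⟨i⟩ := hT.iso_biprod (h 0 le_rfl K hK)
    exact h𝒞.summand _ _ (h𝒞.iso _ _ (i ≪≫ biprod.braiding _ _) hW)
  | succ n ih =>
    obtain ⟨K, W, hW, hK, hT⟩ := hV.exists_triangle
    exact ⟨K, W, hW, ih hK fun i hi Y hY => ExtVanish.left' hT
      (properRes_le_rightPerp _ hY W hW i) (h (i + 1) (by omega) Y hY), hT⟩

lemma leftPerp.left' {A B Z : C} (h : T.Triangle A B Z) (hB : T.leftPerp D B)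
    (hZ : T.leftPerp D Z) : T.leftPerp D A := fun Y hY i =>
  ExtVanish.left' (i := i) h (hB Y hY i) (hZ Y hY (i + 1))

lemma leftPerp.mid' {A B Z : C} (h : T.Triangle A B Z) (hA : T.leftPerp D A)
    (hZ : T.leftPerp D Z) : T.leftPerp D B := fun Y hY i =>
  ExtVanish.mid' (i := i) h (hA Y hY i) (hZ Y hY i)

end Dimension

/-! ### Special preenvelopes and precovers -/

section Coresolving

variable [T.HasEnoughProjectives] [T.HasEnoughInjectives]

/-- If `V ∈ _𝒞𝒳` satisfies `𝔼(V, D) = 0`, then all higher extension groups vanish as well. -/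
lemma leftPerp_of_vanish (h𝒞 : IsSubcategory 𝒞) (hself : T.SelfOrthogonal 𝒞)
    (hfin : T.StronglyCovariantlyFiniteIn D (T.properRes 𝒞))
    (hcone : ∀ A B Z : C, T.Triangle A B Z → D A → D B → D Z)
    {V : C} (hV : T.properRes 𝒞 V) (h : ∀ Y, D Y → T.ExtVanish 0 V Y) : T.leftPerp D V := by
  have key : ∀ (i : ℕ) {V : C}, T.properRes 𝒞 V → (∀ Y, D Y → T.ExtVanish i V Y) →
      ∀ Y, D Y → T.ExtVanish (i + 1) V Y := by
    intro i
    induction i with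
    | zero =>
      intro V hV h Y hY
      obtain ⟨K, W, hW, hK, hT⟩ := hV.exists_triangle
      refine ExtVanish.right' hT (fun e => ?_) (properRes_le_rightPerp _ (hfin.1 _ hY) W hW 1)
      change Elt T.E K Y at e
      -- To see 𝔼(K, Y) = 0, embed the middle term `B` of `e` in an object of `D`. The cone `L` of
      -- `Y ⟶ W'` is in `D` and `e` is pulled back along `c : K ⟶ L`; as 𝔼(V, L) = 0, `c` extends
      -- over `W`, where 𝔼(W, Y) = 0.
      obtain ⟨B, x, y, hB⟩ := T.exists_realizes e
      obtain ⟨W', V', g, p, ⟨δ, hg⟩, hgD⟩ := hfin.2 B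
        ((hfin.1 _ hY).extension h𝒞 hself (triangle_of_realizes hB) hK)
      obtain ⟨L, h', d, q, δ'', hr, -⟩ := T.et4 _ _ _ _ _ _ hB hg
      have hL : D L := hcone _ _ _ (triangle_of_realizes hr) hY hgD.1
      obtain ⟨c, hc⟩ := exists_pull_of_push_eq_zero hr e
        (by rw [push_comp, push_inflation hB, push_zero])
      obtain ⟨θ, j, k, hθ⟩ := hT.exists_realizes
      obtain ⟨m, rfl⟩ := desc_of_push_eq_zero hθ c (h L hL _)
      have hm : pull T.E m δ'' = 0 := properRes_le_rightPerp _ (hfin.1 _ hY) W hW 0 _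
      exact hc.symm.trans ((pull_comp T.E _ _ _).trans
        ((congrArg _ hm).trans (pull_zero T.E j)))
    | succ i ih =>
      intro V hV h Y hY
      obtain ⟨K, W, hW, hK, hT⟩ := hV.exists_triangle
      refine ExtVanish.right' hT (ih hK (fun Y hY => ?_) Y hY)
        (properRes_le_rightPerp _ (hfin.1 _ hY) W hW (i + 2))
      exact ExtVanish.left' hT (properRes_le_rightPerp _ (hfin.1 _ hY) W hW i) (h Y hY)
  intro Y hY i
  induction i generalizing Y with
  | zero => exact h Y hY
  | succ i ih => exact key i hV ih Y hY

lemma exists_special_preenvelope (hKS : IsKrullSchmidt C) (hWIC : T.WIC)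
    (h𝒞 : IsSubcategory 𝒞) (hD : IsSubcategory D) (hself : T.SelfOrthogonal 𝒞)
    (hfin : T.StronglyCovariantlyFiniteIn D (T.properRes 𝒞))
    (hcores : T.RelativeCoresolving D (T.properRes 𝒞)) {M : C} (hM : T.properRes 𝒞 M) :
    ∃ W V, T.Triangle M W V ∧ D W ∧ T.leftPerp D V ∧ T.properRes 𝒞 V := by
  obtain ⟨W, V, g, p, hg, hgD⟩ := hfin.2 M hM
  obtain ⟨W, V, h, hW, hV⟩ :=
    exists_special_left_approx hKS hWIC hD hcores.extension g ⟨V, p, hg⟩ hgD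
  have hV' : T.properRes 𝒞 V := hM.cone h𝒞 hself h (hcores.le _ hW)
  exact ⟨W, V, h, hW, leftPerp_of_vanish h𝒞 hself hfin hcores.cone hV' hV, hV'⟩

lemma exists_special_precover (h𝒞 : IsSubcategory 𝒞) (hself : T.SelfOrthogonal 𝒞)
    (hle : D ≤ T.properRes 𝒞)
    (henv : ∀ M, T.properRes 𝒞 M →
      ∃ W V, T.Triangle M W V ∧ D W ∧ T.leftPerp D V ∧ T.properRes 𝒞 V)
    {M : C} (hM : T.properRes 𝒞 M) :
    ∃ W U, T.Triangle W U M ∧ D W ∧ T.leftPerp D U ∧ T.properRes 𝒞 U := by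
  obtain ⟨K, W₀, hW₀, hK, h⟩ := hM.exists_triangle
  obtain ⟨W, V, h', hW, hV, hV'⟩ := henv K hK
  obtain ⟨U, hU, hU'⟩ := h.pushout h'
  exact ⟨W, U, hU', hW,
    leftPerp.mid' hU (fun Y hY i => properRes_le_rightPerp _ (hle _ hY) W₀ hW₀ i) hV,
    (hle _ hW).extension h𝒞 hself hU' hM⟩

/-- Pulling `X₀ ⟶ M'` back along the precover of `M'` gives `N` in `T.properRes 𝒞`. With `U` a
precover of `N`, the cocone of `U ⟶ N ⟶ U'` covers `M`. -/
lemma exists_hasPrecover_of_checkN (h𝒞 : IsSubcategory 𝒞) (hself : T.SelfOrthogonal 𝒞)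
    (hle : D ≤ T.properRes 𝒞)
    (hcov : ∀ M, T.properRes 𝒞 M → ∃ n, T.HasPrecover D (T.properRes 𝒞) n M)
    {n : ℕ} {M : C} (hM : T.checkN (T.properRes 𝒞) n M) :
    ∃ d, T.HasPrecover D (T.properRes 𝒞) d M := by
  induction n generalizing M with
  | zero => exact hcov M hM
  | succ n ih =>
    obtain ⟨X₀, M', hX₀, hM', h⟩ := hM
    obtain ⟨d', W', U', h', hW', hU', hd'⟩ := ih hM'
    obtain ⟨N, hN, hN'⟩ := h.pullback h'
    obtain ⟨d, W, U, hT, hW, hU, hd⟩ := hcov N ((hle _ hW').extension h𝒞 hself hN' hX₀)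
    obtain ⟨L, hL, hL'⟩ := hN.comp_deflation hT
    refine ⟨max d d', W, L, hL', hW, leftPerp.left' hL hU hU', fun i hi Y hY => ?_⟩
    exact ExtVanish.left' hL (hd i (by omega) Y hY) (hd' (i + 1) (by omega) Y hY)

lemma HasPrecover.extension (hext : ∀ A B Z : C, T.Triangle A B Z → D A → D Z → D B)
    {X : ObjectProperty C} {n : ℕ} {A B Z : C} (h : T.Triangle A B Z)
    (hA : T.HasPrecover D X n A) (hZ : T.HasPrecover D X n Z) : T.HasPrecover D X n B := by
  obtain ⟨W₁, U₁, h₁, hW₁, hU₁, hd₁⟩ := hA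
  obtain ⟨W₂, U₂, h₂, hW₂, hU₂, hd₂⟩ := hZ
  obtain ⟨W, U, hU, hT, hW⟩ := h.horseshoe h₁ h₂ fun δ x y hδ =>
    exists_push_eq hδ (hU₂ W₁ hW₁ 1)
  exact ⟨W, U, hT, hext _ _ _ hW hW₁ hW₂, leftPerp.mid' hU hU₁ hU₂, fun i hi Y hY =>
    ExtVanish.mid' hU (hd₁ i hi Y hY) (hd₂ i hi Y hY)⟩

lemma HasPrecover.of_isZero (hD : IsSubcategory D) {X : ObjectProperty C} {n : ℕ} {O : C}
    (hO : IsZero O) : T.HasPrecover D X n O := by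
  have h : ∀ i Y, T.ExtVanish i O Y := fun i Y => by
    rw [extVanish_iff]
    intro e
    rw [← pull_id T.E e, hO.eq_of_src (𝟙 O) 0, zero_pull]
  exact ⟨O, O, T.triangle_zero_left O hO, hD.zero _ hO, fun Y _ i => h i Y, fun i _ Y _ => h i Y⟩

lemma HasFiltration.hasPrecover (hD : IsSubcategory D)
    (hext : ∀ A B Z : C, T.Triangle A B Z → D A → D Z → D B)
    {X : ObjectProperty C} {n : ℕ} {S : Set C} (hS : ∀ Q ∈ S, T.HasPrecover D X n Q) {M : C}
    (hM : T.HasFiltration S M) : T.HasPrecover D X n M := by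
  induction hM with
  | base O M Q hO hQ hT => exact HasPrecover.extension hext hT (.of_isZero hD hO) (hS Q hQ)
  | step M' M Q _ hQ hT ih => exact HasPrecover.extension hext hT ih (hS Q hQ)

/-- Since 𝔼(V, W) = 0 the precover splits, so `V` is a retract of `U`. -/
lemma HasPrecover.dimLE {X : ObjectProperty C} {n : ℕ} {V : C} (h : T.HasPrecover D X n V)
    (hV : T.leftPerp D V) : T.DimLE X n V := by
  obtain ⟨W, U, hT, hW, -, hd⟩ := h
  obtain ⟨δ, x, y, hδ⟩ := hT.exists_realizes
  obtain rfl : δ = 0 := hV W hW 0 δ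
  obtain ⟨s, hs⟩ := exists_section_of_realizes_zero hδ
  exact fun i hi Y hY => ExtVanish.retract s y hs (hd i hi Y hY)

end Coresolving

end ExtriangulatedStructure
end Extri

/-! ### The equivalence -/

theorem mainTheorem9 {𝒜 : Type u} [Category.{v} 𝒜] [Preadditive 𝒜] [HasZeroObject 𝒜]
    [HasBinaryBiproducts 𝒜]
    (T : Extri.ExtriangulatedStructure.{w} 𝒜)
    (hKS : Extri.IsKrullSchmidt 𝒜) [T.HasEnoughProjectives] [T.HasEnoughInjectives]
    (hWIC : T.WIC)
    (𝒞 𝒟 : ObjectProperty 𝒜)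
    (h𝒞 : Extri.IsSubcategory 𝒞) (h𝒟 : Extri.IsSubcategory 𝒟)
    (hself : T.SelfOrthogonal 𝒞)
    (hfilt : T.FinitelyFiltered (T.check (T.properRes 𝒞)))
    (hfin : T.StronglyCovariantlyFiniteIn 𝒟 (T.properRes 𝒞))
    (hcores : T.RelativeCoresolving 𝒟 (T.properRes 𝒞)) :
    T.check 𝒟 = T.check (T.properRes 𝒞) ↔
      T.leftPerp 𝒟 ⊓ T.properRes 𝒞 ≤ T.hat 𝒞 := by
  open Extri Extri.ExtriangulatedStructure in
  obtain ⟨S, hS, hSX, hSf⟩ := hfilt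
  have hX : T.properRes 𝒞 ≤ T.check (T.properRes 𝒞) := fun M hM => ⟨0, hM⟩
  constructor
  · rintro heq V ⟨hV, hV'⟩
    obtain ⟨N, hN⟩ := exists_uniform_bound hS (P := fun n Q => ∀ i, n ≤ i → T.ExtVanish i V Q)
      (fun m n Q hmn h i hi => h i (hmn.trans hi)) (fun Q hQ => by
        obtain ⟨n, hn⟩ := heq.ge _ (hSX Q hQ)
        exact ⟨n, extVanish_of_checkN hn hV⟩)
    exact ⟨N, hatN_of_dimLE h𝒞 hV' fun i hi Y hY =>
      HasFiltration.extVanish (hSf Y (hX Y hY)) fun Q hQ => hN Q hQ i hi⟩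
  · intro hhat
    have henv : ∀ M, T.properRes 𝒞 M →
        ∃ W V, T.Triangle M W V ∧ 𝒟 W ∧ T.leftPerp 𝒟 V ∧ T.properRes 𝒞 V := fun M hM =>
      exists_special_preenvelope hKS hWIC h𝒞 h𝒟 hself hfin hcores hM
    have hcov : ∀ M, T.properRes 𝒞 M → ∃ n, T.HasPrecover 𝒟 (T.properRes 𝒞) n M := by
      intro M hM
      obtain ⟨W, U, hT, hW, hU, hU'⟩ := exists_special_precover h𝒞 hself hcores.le henv hM
      obtain ⟨n, hn⟩ := hhat U ⟨hU, hU'⟩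
      exact ⟨n, W, U, hT, hW, hU, fun i hi Y hY =>
        DimLE.of_hatN hn i hi Y (properRes_le_rightPerp _ hY)⟩
    obtain ⟨N, hN⟩ := exists_uniform_bound hS
      (P := fun n Q => T.HasPrecover 𝒟 (T.properRes 𝒞) n Q) (fun m n Q hmn h => h.mono hmn)
      (fun Q hQ => by
        obtain ⟨n, hn⟩ := hSX Q hQ
        exact exists_hasPrecover_of_checkN h𝒞 hself hcores.le hcov hn)
    refine le_antisymm (check_le_check hcores.le)
      (check_le_check_of_properRes_le h𝒞 hself henv fun M hM => ⟨N, ?_⟩)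
    -- The filtration is applied to the test object `V`, not to `M`: it bounds the dimension of
    -- every `V` by the same `N`.
    exact checkN_of_extVanish h𝒟 henv hM fun V hV hV' i hi =>
      ((hSf V (hX V hV')).hasPrecover h𝒟 hcores.extension hN).dimLE hV i hi M hM
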